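/- For complex $a,q$ with $|q|<1$ let $(a;q)_k=\prod_{j=0}^{k-1}(1-aq^j)$ for $k\in\mathbb Z_{\ge 0}\cup\{\infty\}$, and let $$H(q)=\sum_{k=0}^\infty\frac{q^{k^2+k}}{(q;q)_k}.$$ Let $q\in\mathbb C$ with $|q|<1$, fix any fourth root $q^{1/4}$ of $q$, and put $q^{1/2}=(q^{1/4})^2$. Then the series defining $H(q)$ and all series below converge, and $$H(q)=\bigl(q^{1/2};q\bigr)_\infty\sum_{k=0}^\infty\frac{q^{k(3k+5)/4}}{\bigl(q^{1/2};q^{1/2}\bigr)_k\bigl(q^{1/2};q\bigr)_{k+2}},$$ $$H(q)=(-q;q)_\infty\sum_{k=0}^\infty\frac{(-1)^kq^{k(3k+2)}}{(q^4;q^4)_k(-q;q^2)_{k+1}},$$ $$H(q)=(-q;q)_\infty\sum_{k=0}^\infty\frac{(-1)^kq^{k(3k-2)}}{(q^4;q^4)_k(-q;q^2)_{k}}.$$ Moreover $H(q)=\dfrac1{(q^2;q^5)_\infty(q^3;q^5)_\infty}$, so that these become the product formulas $$\sum_{k=0}^\infty\frac{q^{k(3k+5)/4}}{\bigl(q^{1/2};q^{1/2}\bigr)_k\bigl(q^{1/2};q\bigr)_{k+2}}=\frac1{(q^{1/2};q)_\infty(q^2;q^5)_\infty(q^3;q^5)_\infty},$$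 $$\sum_{k=0}^\infty\frac{(-1)^kq^{k(3k+2)}}{(q^4;q^4)_k(-q;q^2)_{k+1}}=\sum_{k=0}^\infty\frac{(-1)^kq^{k(3k-2)}}{(q^4;q^4)_k(-q;q^2)_{k}}=\frac1{(-q;q)_\infty(q^2;q^5)_\infty(q^3;q^5)_\infty}.$$ -/

import Mathlib

/-- The finite `q`-shifted factorial `(a; q)_k = ∏_{j=0}^{k-1} (1 - a q^j)`. -/
noncomputable def qPoch (a q : ℂ) (k : ℕ) : ℂ :=
  ∏ j ∈ Finset.range k, (1 - a * q ^ j)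

/-- The infinite `q`-shifted factorial `(a; q)_∞ = ∏_{j=0}^∞ (1 - a q^j)`, for `|q| < 1`. -/
noncomputable def qPochInf (a q : ℂ) : ℂ :=
  ∏' j : ℕ, (1 - a * q ^ j)

/-- The product defining `(a; q)_∞` converges for `|q| < 1`. -/
theorem multipliable_qPochInf (a : ℂ) {q : ℂ} (hq : ‖q‖ < 1) :
    Multipliable (fun j : ℕ => 1 - a * q ^ j) := by
  have h : Summable (fun j : ℕ => ‖-(a * q ^ j)‖) := by
    simp only [norm_neg, norm_mul, norm_pow]
    exact (summable_geometric_of_lt_one (norm_nonneg q) hq).mul_left _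
  simpa only [sub_eq_add_neg] using multipliable_one_add_of_summable h

/-- `R(t; q) = ∑_{k ≥ 0} q^{k^2} t^k / (q; q)_k`. -/
noncomputable def rrR (t q : ℂ) : ℂ :=
  ∑' k : ℕ, q ^ (k ^ 2) * t ^ k / qPoch q q k

/-- The Rogers–Ramanujan function `H(q) = R(q; q)`. -/
noncomputable def rrH (q : ℂ) : ℂ := rrR q q

/-! All three series come from one mechanism. In a sum of `b j * (-y q^j; q)_∞`, expand each
infinite product by Euler (`tsum_eulerTerm`) and collect terms of equal total degree
(`hasSum_mul_qPochInf`). For suitable `b` the inner finite sum is a coefficient of a product of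
power series, evaluated by `(-x; q)_∞ = (x²; q²)_∞ / (x; q)_∞` or `(-x; q²)_∞ = (-x; q)_∞ / (-qx;
q²)_∞`. The first factorization expands `R(t; q)` for every `t` (`hasSum_rrR`): `t = q` gives the
series with `k(3k+2)`, while `t = 1` and `t = q²`, joined by `R(q) = R(1) - q R(q²)`, give the one
with `k(3k-2)`. The second factorization, in base `q^{1/2}`, gives the remaining series.

The product formula follows Rogers. Sums built from `rogersSum` satisfy the same second-order
recurrence as `R(q^n; q)`, and a solution is determined by its limit (`eq_zero_of_recurrence`).
Hence `(q; q)_∞ H(q)` is a theta series, which `jacobi_triple_product` turns into a product. -/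

open Filter Topology

/-! ### Elementary properties of `q`-shifted factorials -/

theorem qPoch_zero (a q : ℂ) : qPoch a q 0 = 1 := by simp [qPoch]

theorem qPoch_succ (a q : ℂ) (k : ℕ) :
    qPoch a q (k + 1) = qPoch a q k * (1 - a * q ^ k) := by
  simp [qPoch, Finset.prod_range_succ]

theorem qPoch_add (a q : ℂ) (k n : ℕ) :
    qPoch a q (k + n) = qPoch a q k * qPoch (a * q ^ k) q n := by
  simp [qPoch, Finset.prod_range_add, pow_add, mul_assoc]

theorem tendsto_qPoch (a : ℂ) {q : ℂ} (hq : ‖q‖ < 1) :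
    Tendsto (qPoch a q) atTop (𝓝 (qPochInf a q)) :=
  (multipliable_qPochInf a hq).hasProd.tendsto_prod_nat

theorem qPochInf_eq_mul (a : ℂ) {q : ℂ} (hq : ‖q‖ < 1) (k : ℕ) :
    qPochInf a q = qPoch a q k * qPochInf (a * q ^ k) q := by
  have h1 : Tendsto (fun n => qPoch a q (k + n)) atTop (𝓝 (qPochInf a q)) := by
    simpa only [add_comm k] using (tendsto_add_atTop_iff_nat k).2 (tendsto_qPoch a hq)
  refine tendsto_nhds_unique h1 ?_
  simp only [qPoch_add]
  exact (tendsto_qPoch _ hq).const_mul _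

theorem norm_mul_pow_lt_one {a q : ℂ} (ha : ‖a‖ < 1) (hq : ‖q‖ < 1) (j : ℕ) :
    ‖a * q ^ j‖ < 1 := by
  rw [norm_mul, norm_pow]
  exact mul_lt_one_of_nonneg_of_lt_one_left (norm_nonneg _) ha
    (pow_le_one₀ (norm_nonneg _) hq.le)

theorem one_sub_ne_zero_of_norm_lt_one {z : ℂ} (hz : ‖z‖ < 1) : 1 - z ≠ 0 := by
  intro h
  rw [← sub_eq_zero.1 h] at hz
  simp at hz

theorem qPoch_ne_zero {a q : ℂ} (ha : ‖a‖ < 1) (hq : ‖q‖ < 1) (k : ℕ) : qPoch a q k ≠ 0 :=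
  Finset.prod_ne_zero_iff.2 fun j _ =>
    one_sub_ne_zero_of_norm_lt_one (norm_mul_pow_lt_one ha hq j)

theorem qPochInf_ne_zero {a q : ℂ} (ha : ‖a‖ < 1) (hq : ‖q‖ < 1) : qPochInf a q ≠ 0 := by
  have h := tprod_one_add_ne_zero_of_summable (f := fun j : ℕ => -(a * q ^ j))
    (fun j => by
      rw [← sub_eq_add_neg]
      exact one_sub_ne_zero_of_norm_lt_one (norm_mul_pow_lt_one ha hq j))
    (by
      simp only [norm_neg, norm_mul, norm_pow]
      exact (summable_geometric_of_lt_one (norm_nonneg q) hq).mul_left _)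
  simpa only [qPochInf, sub_eq_add_neg] using h

theorem exists_norm_qPoch_le (a : ℂ) {q : ℂ} (hq : ‖q‖ < 1) :
    ∃ C, 0 < C ∧ ∀ k, ‖qPoch a q k‖ ≤ C := by
  obtain ⟨C, hC, h⟩ := (Metric.isBounded_range_of_tendsto _ (tendsto_qPoch a hq)).exists_pos_norm_le
  exact ⟨C, hC, fun k => h _ ⟨k, rfl⟩⟩

theorem exists_norm_qPoch_inv_le {a q : ℂ} (ha : ‖a‖ < 1) (hq : ‖q‖ < 1) :
    ∃ C, 0 < C ∧ ∀ k, ‖(qPoch a q k)⁻¹‖ ≤ C := by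
  obtain ⟨C, hC, h⟩ := (Metric.isBounded_range_of_tendsto _
    ((tendsto_qPoch a hq).inv₀ (qPochInf_ne_zero ha hq))).exists_pos_norm_le
  exact ⟨C, hC, fun k => h _ ⟨k, rfl⟩⟩

/-! ### Quadratic exponents and absolute convergence -/

theorem choose_two_succ (k : ℕ) : (k + 1).choose 2 = k.choose 2 + k := by
  rw [Nat.choose_succ_succ' k 1, Nat.choose_one_right, add_comm]

theorem sq_eq_choose_two (k : ℕ) : k ^ 2 = 2 * k.choose 2 + k := by
  induction k with
  | zero => rfl
  | succ k ih => rw [choose_two_succ]; linarith [ih, add_sq k 1]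

theorem choose_two_add (m n : ℕ) :
    (m + n).choose 2 = m.choose 2 + n.choose 2 + m * n := by
  have h1 := sq_eq_choose_two (m + n)
  have h2 := sq_eq_choose_two m
  have h3 := sq_eq_choose_two n
  nlinarith

/-- Superexponential decay of the terms `q^{n(n-1)/2} x^n`. -/
theorem summable_norm_pow_choose_two_mul_pow {q : ℂ} (hq : ‖q‖ < 1) (x : ℂ) :
    Summable fun n : ℕ => ‖q ^ n.choose 2 * x ^ n‖ := by
  have hlim : Tendsto (fun n : ℕ => ‖x‖ * ‖q‖ ^ n) atTop (𝓝 0) := by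
    simpa using (tendsto_pow_atTop_nhds_zero_of_lt_one (norm_nonneg q) hq).const_mul ‖x‖
  refine Summable.norm (summable_of_ratio_norm_eventually_le (r := 1 / 2) (by norm_num) ?_)
  filter_upwards [hlim.eventually_le_const (show (0 : ℝ) < 1 / 2 by norm_num)] with n hn
  have : q ^ (n + 1).choose 2 * x ^ (n + 1) = (x * q ^ n) * (q ^ n.choose 2 * x ^ n) := by
    rw [choose_two_succ]; ring
  rw [this, norm_mul]
  refine mul_le_mul_of_nonneg_right ?_ (norm_nonneg _)
  simpa using hn

/-- A series whose terms are dominated by `C q^{n(n-1)/2} x^n` converges absolutely. -/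
theorem summable_norm_of_le_choose_two {q : ℂ} (hq : ‖q‖ < 1) (x : ℂ) (C : ℝ) {f : ℕ → ℂ}
    (h : ∀ n, ‖f n‖ ≤ C * ‖q ^ n.choose 2 * x ^ n‖) : Summable fun n => ‖f n‖ :=
  Summable.of_nonneg_of_le (fun _ => norm_nonneg _) h
    ((summable_norm_pow_choose_two_mul_pow hq x).mul_left C)

/-! ### Euler's expansion and rearrangement of double series -/

/-- The general term of Euler's expansion of `(-y; q)_∞`. -/
noncomputable def eulerTerm (q y : ℂ) (n : ℕ) : ℂ := q ^ n.choose 2 * y ^ n / qPoch q q n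

theorem exists_norm_eulerTerm_le {q : ℂ} (hq : ‖q‖ < 1) :
    ∃ C, 0 < C ∧ ∀ y n, ‖eulerTerm q y n‖ ≤ C * ‖q ^ n.choose 2 * y ^ n‖ := by
  obtain ⟨C, hC, h⟩ := exists_norm_qPoch_inv_le hq hq
  refine ⟨C, hC, fun y n => ?_⟩
  rw [eulerTerm, div_eq_mul_inv, norm_mul, mul_comm]
  exact mul_le_mul_of_nonneg_right (h n) (norm_nonneg _)

theorem summable_norm_eulerTerm {q : ℂ} (hq : ‖q‖ < 1) (y : ℂ) :
    Summable fun n => ‖eulerTerm q y n‖ := by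
  obtain ⟨C, -, h⟩ := exists_norm_eulerTerm_le hq
  exact summable_norm_of_le_choose_two hq y C (h y)

/-- In the difference of the series at `y` and at `y q`, the factor `1 - q^n` cancels the last
factor of `(q; q)_n`; shifting the index leaves `y` times the series at `y q`. -/
theorem tsum_eulerTerm_eq {q : ℂ} (hq : ‖q‖ < 1) (y : ℂ) :
    ∑' n, eulerTerm q y n = (1 + y) * ∑' n, eulerTerm q (y * q) n := by
  have hs := (summable_norm_eulerTerm hq y).of_norm
  have hs' := (summable_norm_eulerTerm hq (y * q)).of_norm
  have key : ∑' n, (eulerTerm q y n - eulerTerm q (y * q) n) =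
      y * ∑' n, eulerTerm q (y * q) n := by
    rw [(hs.sub hs').tsum_eq_zero_add, ← tsum_mul_left]
    simp only [eulerTerm, Nat.choose_zero_succ, pow_zero, sub_self, zero_add]
    refine tsum_congr fun n => ?_
    have h1 := qPoch_ne_zero hq hq n
    have h2 : 1 - q * q ^ n ≠ 0 :=
      one_sub_ne_zero_of_norm_lt_one (norm_mul_pow_lt_one hq hq n)
    rw [qPoch_succ, choose_two_succ]
    field_simp
    ring
  rw [hs.tsum_sub hs'] at key
  linear_combination key

/-- Euler's expansion of `(-y; q)_∞`. -/
theorem tsum_eulerTerm {q : ℂ} (hq : ‖q‖ < 1) (y : ℂ) :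
    ∑' n, eulerTerm q y n = qPochInf (-y) q := by
  have h1 : ∀ N : ℕ, ∑' n, eulerTerm q y n =
      qPoch (-y) q N * ∑' n, eulerTerm q (y * q ^ N) n := by
    intro N
    induction N with
    | zero => simp [qPoch_zero]
    | succ N ih =>
      rw [ih, tsum_eulerTerm_eq hq, qPoch_succ, pow_succ]
      ring_nf
  -- As `y q^N → 0`, dominated convergence leaves only the constant term.
  have h2 : Tendsto (fun N : ℕ => ∑' n, eulerTerm q (y * q ^ N) n) atTop
      (𝓝 (∑' n, if n = 0 then 1 else 0)) := by
    obtain ⟨C, hC, hle⟩ := exists_norm_eulerTerm_le hq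
    refine tendsto_tsum_of_dominated_convergence
      ((summable_norm_pow_choose_two_mul_pow hq y).mul_left C) (fun n => ?_)
      (Eventually.of_forall fun N n => (hle _ n).trans ?_)
    · have h0 : Tendsto (fun N : ℕ => y * q ^ N) atTop (𝓝 0) := by
        simpa using (tendsto_pow_atTop_nhds_zero_of_norm_lt_one hq).const_mul y
      rcases n with _ | n
      · simp [eulerTerm, qPoch_zero]
      · simpa [eulerTerm] using
          ((h0.pow (n + 1)).const_mul (q ^ (n + 1).choose 2)).div_const (qPoch q q (n + 1))
    · refine mul_le_mul_of_nonneg_left ?_ hC.le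
      simp only [norm_mul, norm_pow]
      gcongr
      exact mul_le_of_le_one_right (norm_nonneg _) (pow_le_one₀ (norm_nonneg _) hq.le)
  have h3 := (tendsto_qPoch (-y) hq).mul h2
  simp only [tsum_ite_eq, mul_one] at h3
  refine tendsto_nhds_unique (tendsto_const_nhds.congr fun N => h1 N) h3

theorem summable_norm_mul_eulerTerm {q : ℂ} (hq : ‖q‖ < 1) (y : ℂ) {b : ℕ → ℂ}
    (hb : Summable fun j => ‖b j‖) :
    Summable fun x : ℕ × ℕ => ‖b x.1 * eulerTerm q (y * q ^ x.1) x.2‖ := by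
  obtain ⟨C, hC, hle⟩ := exists_norm_eulerTerm_le hq
  refine Summable.of_nonneg_of_le (fun _ => norm_nonneg _) (fun x => ?_)
    (hb.mul_of_nonneg ((summable_norm_pow_choose_two_mul_pow hq y).mul_left C)
      (fun _ => norm_nonneg _) (fun _ => by positivity))
  rw [norm_mul]
  refine mul_le_mul_of_nonneg_left ((hle _ _).trans ?_) (norm_nonneg _)
  refine mul_le_mul_of_nonneg_left ?_ hC.le
  simp only [norm_mul, norm_pow]
  gcongr
  exact mul_le_of_le_one_right (norm_nonneg _) (pow_le_one₀ (norm_nonneg _) hq.le)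

/-- The absolutely convergent double series is summed by rows, where Euler's expansion applies, and
by antidiagonals. -/
theorem hasSum_mul_qPochInf {q : ℂ} (hq : ‖q‖ < 1) (y : ℂ) {b : ℕ → ℂ}
    (hb : Summable fun j => ‖b j‖) :
    HasSum (fun j => b j * qPochInf (-(y * q ^ j)) q)
      (∑' n, ∑ x ∈ Finset.HasAntidiagonal.antidiagonal n, b x.1 * eulerTerm q (y * q ^ x.1) x.2) := by
  have hs := (summable_norm_mul_eulerTerm hq y hb).of_norm
  have h1 := hs.hasSum.prod_fiberwise fun j =>
    ((summable_norm_eulerTerm hq (y * q ^ j)).of_norm.hasSum.mul_left (b j))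
  simp only [tsum_eulerTerm hq] at h1
  suffices h : ∑' n, ∑ x ∈ Finset.HasAntidiagonal.antidiagonal n,
      b x.1 * eulerTerm q (y * q ^ x.1) x.2 =
      ∑' x : ℕ × ℕ, b x.1 * eulerTerm q (y * q ^ x.1) x.2 by rwa [h]
  rw [← Finset.HasAntidiagonal.sigmaAntidiagonalEquivProd.tsum_eq]
  refine Eq.symm ((Summable.tsum_sigma
    ((Finset.HasAntidiagonal.sigmaAntidiagonalEquivProd.summable_iff).2 hs)).trans ?_)
  refine tsum_congr fun n => ?_
  rw [tsum_fintype]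
  exact Finset.sum_coe_sort (Finset.HasAntidiagonal.antidiagonal n)
    fun x : ℕ × ℕ => b x.1 * eulerTerm q (y * q ^ x.1) x.2

/-! ### Finite convolutions as coefficients of formal power series -/

section FormalPowerSeries

open PowerSeries

theorem mk_eulerTerm_eq {q : ℂ} (hq : ‖q‖ < 1) :
    mk (eulerTerm q 1) = (1 + X) * rescale q (mk (eulerTerm q 1)) := by
  ext n
  rw [add_mul, one_mul, map_add]
  rcases n with _ | n
  · simp [eulerTerm]
  · rw [coeff_succ_X_mul, coeff_rescale, coeff_rescale, coeff_mk, coeff_mk]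
    have h1 := qPoch_ne_zero hq hq n
    have h2 : 1 - q * q ^ n ≠ 0 :=
      one_sub_ne_zero_of_norm_lt_one (norm_mul_pow_lt_one hq hq n)
    simp only [eulerTerm, qPoch_succ, choose_two_succ]
    field_simp
    ring

/-- The functional equation gives `(1 - q^{n+1}) a_{n+1} = q^n a_n`, so the constant term fixes all
coefficients. Product identities thus reduce to a functional equation, with no convergence in `X` to
check. -/
theorem coeff_eq_eulerTerm {q : ℂ} (hq : ‖q‖ < 1) {F : PowerSeries ℂ} (h0 : coeff 0 F = 1)
    (h : F = (1 + X) * rescale q F) (n : ℕ) : coeff n F = eulerTerm q 1 n := by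
  induction n with
  | zero => simpa [eulerTerm, qPoch_zero] using h0
  | succ n ih =>
    have hF := congrArg (coeff (n + 1)) h
    rw [add_mul, one_mul, map_add, coeff_succ_X_mul, coeff_rescale, coeff_rescale, ih] at hF
    have h1 := qPoch_ne_zero hq hq n
    have h2 : 1 - q * q ^ n ≠ 0 :=
      one_sub_ne_zero_of_norm_lt_one (norm_mul_pow_lt_one hq hq n)
    have h3 : coeff (n + 1) F * (1 - q * q ^ n) = q ^ n * eulerTerm q 1 n := by
      linear_combination hF
    rw [eq_div_of_mul_eq h2 h3]
    simp only [eulerTerm, qPoch_succ, choose_two_succ]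
    field_simp
    ring

/-- This is the functional equation of `1 / (y x; q)_∞`. -/
theorem rescale_mk_inv_qPoch {q : ℂ} (hq : ‖q‖ < 1) (y : ℂ) :
    rescale q (mk fun n => y ^ n / qPoch q q n) =
      (1 - C y * X) * mk fun n => y ^ n / qPoch q q n := by
  ext n
  rw [sub_mul, one_mul, map_sub, mul_assoc, coeff_C_mul]
  rcases n with _ | n
  · simp
  · rw [coeff_succ_X_mul, coeff_rescale, coeff_mk, coeff_mk]
    have h1 := qPoch_ne_zero hq hq n
    have h2 : 1 - q * q ^ n ≠ 0 :=
      one_sub_ne_zero_of_norm_lt_one (norm_mul_pow_lt_one hq hq n)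
    simp only [qPoch_succ]
    field_simp
    ring

/-- The sequence with `c k` at position `2 k` and `0` at odd positions. -/
noncomputable def evenExtend (c : ℕ → ℂ) : ℕ → ℂ := Function.extend (fun k => 2 * k) c 0

theorem two_mul_injective : Function.Injective fun k : ℕ => 2 * k := fun a b h => by
  simpa using h

theorem evenExtend_two_mul (c : ℕ → ℂ) (k : ℕ) : evenExtend c (2 * k) = c k :=
  two_mul_injective.extend_apply c 0 k

theorem evenExtend_odd (c : ℕ → ℂ) (k : ℕ) : evenExtend c (2 * k + 1) = 0 :=
  Function.extend_apply' _ _ _ (by rintro ⟨a, ha⟩; omega)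

/-- The series is `(x²; q²)_∞`, from which the factor `1 - x²` splits off. -/
theorem mk_evenExtend_eq {q : ℂ} (hq : ‖q‖ < 1) :
    mk (evenExtend (eulerTerm (q ^ 2) (-1))) =
      (1 - X ^ 2) * rescale q (mk (evenExtend (eulerTerm (q ^ 2) (-1)))) := by
  have hq2 : ‖q ^ 2‖ < 1 := by
    rw [norm_pow]; exact pow_lt_one₀ (norm_nonneg _) hq two_ne_zero
  ext n
  rw [sub_mul, one_mul, map_sub, coeff_X_pow_mul', coeff_rescale, coeff_mk]
  obtain ⟨k, rfl | rfl⟩ := n.even_or_odd'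
  · rcases k with _ | k
    · simp
    · rw [if_pos (by omega), show 2 * (k + 1) - 2 = 2 * k by omega, coeff_rescale, coeff_mk,
        evenExtend_two_mul, evenExtend_two_mul]
      have h1 := qPoch_ne_zero hq2 hq2 k
      have h2 : 1 - q ^ 2 * (q ^ 2) ^ k ≠ 0 :=
        one_sub_ne_zero_of_norm_lt_one (norm_mul_pow_lt_one hq2 hq2 k)
      simp only [eulerTerm, qPoch_succ, choose_two_succ]
      field_simp
      ring
  · rcases k with _ | k
    · rw [evenExtend_odd]; simp
    · rw [if_pos (by omega), show 2 * (k + 1) + 1 - 2 = 2 * k + 1 by omega, coeff_rescale,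
        coeff_mk, evenExtend_odd, evenExtend_odd]
      simp

/-- The coefficients of `(-x; q)_∞ = (x²; q²)_∞ / (x; q)_∞`. -/
theorem sum_evenExtend_div_qPoch {q : ℂ} (hq : ‖q‖ < 1) (n : ℕ) :
    ∑ x ∈ Finset.HasAntidiagonal.antidiagonal n,
      evenExtend (eulerTerm (q ^ 2) (-1)) x.1 * (1 / qPoch q q x.2) = eulerTerm q 1 n := by
  have hA := rescale_mk_inv_qPoch hq 1
  have hB := mk_evenExtend_eq hq
  set A := mk fun n => 1 ^ n / qPoch q q n with hAdef
  set B := mk (evenExtend (eulerTerm (q ^ 2) (-1))) with hBdef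
  -- Here `1 - X²` from `B`, with `1 - X` absorbed by rescaling `A`, leaves the factor `1 + X`.
  have h := coeff_eq_eulerTerm hq (F := B * A) (by
      have := evenExtend_two_mul (eulerTerm (q ^ 2) (-1)) 0
      simp only [mul_zero] at this
      simp [hAdef, hBdef, this, eulerTerm, qPoch_zero]) (by
      rw [map_mul, hA]
      nth_rw 1 [hB]
      rw [map_one]
      ring) n
  rw [← h, coeff_mul]
  simp [hAdef, hBdef]

/-- The coefficients of `(-x; q²)_∞ = (-x; q)_∞ / (-q x; q²)_∞`. -/
theorem sum_eulerTerm_mul_div_qPoch {q : ℂ} (hq : ‖q‖ < 1) (n : ℕ) :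
    ∑ x ∈ Finset.HasAntidiagonal.antidiagonal n,
      eulerTerm q 1 x.1 * ((-q) ^ x.2 / qPoch (q ^ 2) (q ^ 2) x.2) = eulerTerm (q ^ 2) 1 n := by
  have hq2 : ‖q ^ 2‖ < 1 := by
    rw [norm_pow]; exact pow_lt_one₀ (norm_nonneg _) hq two_ne_zero
  have hA := rescale_mk_inv_qPoch hq2 (-q)
  have hB : mk (eulerTerm q 1) =
      (1 + X) * (1 + C q * X) * rescale (q ^ 2) (mk (eulerTerm q 1)) := by
    have h := mk_eulerTerm_eq hq
    have h' := congrArg (rescale q) h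
    rw [map_mul, map_add, map_one, rescale_X, rescale_rescale, ← pow_two] at h'
    rw [mul_assoc, ← h', ← h]
  set A := mk fun n => (-q) ^ n / qPoch (q ^ 2) (q ^ 2) n with hAdef
  set B := mk (eulerTerm q 1) with hBdef
  have h := coeff_eq_eulerTerm hq2 (F := B * A) (by
      simp [hAdef, hBdef, eulerTerm, qPoch_zero]) (by
      rw [map_mul, hA]
      nth_rw 1 [hB]
      rw [map_neg]
      ring) n
  rw [← h, coeff_mul]
  simp [hAdef, hBdef]

end FormalPowerSeries

/-! ### The three series for `H(q)` -/

theorem evenExtend_of_notMem (c : ℕ → ℂ) (j : ℕ) (hj : j ∉ Set.range fun k : ℕ => 2 * k) :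
    evenExtend c j = 0 :=
  Function.extend_apply' _ _ _ hj

theorem summable_norm_evenExtend {c : ℕ → ℂ} (hc : Summable fun k => ‖c k‖) :
    Summable fun j => ‖evenExtend c j‖ := by
  refine (two_mul_injective.summable_iff fun j hj => ?_).1 (hc.congr fun k => ?_)
  · rw [evenExtend_of_notMem c j hj, norm_zero]
  · rw [Function.comp_apply, evenExtend_two_mul]

theorem summable_norm_div_qPoch {a q Q : ℂ} (ha : ‖a‖ < 1) (hq : ‖q‖ < 1) (hQ : ‖Q‖ < 1)
    (x : ℂ) : Summable fun k : ℕ => ‖Q ^ k.choose 2 * x ^ k / qPoch a q k‖ := by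
  obtain ⟨C, hC, h⟩ := exists_norm_qPoch_inv_le ha hq
  refine summable_norm_of_le_choose_two hQ x C fun n => ?_
  rw [div_eq_mul_inv, norm_mul, mul_comm]
  exact mul_le_mul_of_nonneg_right (h n) (norm_nonneg _)

theorem norm_pow_lt_one {q : ℂ} (hq : ‖q‖ < 1) {n : ℕ} (hn : n ≠ 0) : ‖q ^ n‖ < 1 := by
  rw [norm_pow]
  exact pow_lt_one₀ (norm_nonneg _) hq hn

theorem summable_rrR {q : ℂ} (hq : ‖q‖ < 1) (t : ℂ) :
    Summable fun k : ℕ => q ^ (k ^ 2) * t ^ k / qPoch q q k := by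
  refine (summable_norm_div_qPoch hq hq (norm_pow_lt_one hq two_ne_zero) (q * t)).of_norm.congr
    fun k => ?_
  rw [sq_eq_choose_two]
  ring

/-- Expansion of `R(t; q)` obtained from `(-x; q)_∞ = (x²; q²)_∞ / (x; q)_∞`. -/
theorem hasSum_rrR {q : ℂ} (hq : ‖q‖ < 1) (t : ℂ) :
    HasSum (fun k : ℕ => (-1) ^ k * t ^ (2 * k) * q ^ (3 * k ^ 2) / qPoch (q ^ 2) (q ^ 2) k *
      qPochInf (-(t * q ^ (2 * k + 1))) q) (rrR t q) := by
  have hq2 := norm_pow_lt_one hq two_ne_zero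
  set c : ℕ → ℂ := fun k => (-1) ^ k * t ^ (2 * k) * q ^ (3 * k ^ 2) / qPoch (q ^ 2) (q ^ 2) k
    with hc
  have hcs : Summable fun k => ‖c k‖ := by
    refine (summable_norm_div_qPoch hq2 hq2 (norm_pow_lt_one hq (show 6 ≠ 0 by norm_num))
      (-t ^ 2 * q ^ 3)).congr fun k => ?_
    rw [hc]
    simp only [sq_eq_choose_two k]
    congr 2
    rw [mul_pow, neg_pow]
    ring
  have h := hasSum_mul_qPochInf hq (t * q) (summable_norm_evenExtend hcs)
  rw [← two_mul_injective.hasSum_iff (fun j hj => by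
    rw [evenExtend_of_notMem c j hj, zero_mul])] at h
  convert h using 1
  · funext k
    rw [Function.comp_apply, evenExtend_two_mul, hc,
      show t * q * q ^ (2 * k) = t * q ^ (2 * k + 1) by ring]
  · refine tsum_congr fun n => ?_
    -- The exponent `3k²` in `c` makes the powers of `t` and `q` depend on `n` alone, up to the
    -- coefficients in the convolution.
    have h1 : ∀ x ∈ Finset.HasAntidiagonal.antidiagonal n,
        evenExtend c x.1 * eulerTerm q (t * q * q ^ x.1) x.2 =
        (t ^ n * q ^ (n.choose 2 + n)) *
          (evenExtend (eulerTerm (q ^ 2) (-1)) x.1 * (1 / qPoch q q x.2)) := by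
      rintro ⟨j, m⟩ hx
      obtain rfl : j + m = n := by simpa using hx
      obtain ⟨k, rfl | rfl⟩ := j.even_or_odd'
      · have h3 : (2 * k).choose 2 = 4 * k.choose 2 + k := by
          have := sq_eq_choose_two (2 * k)
          have := sq_eq_choose_two k
          nlinarith
        simp only [evenExtend_two_mul, hc, eulerTerm, choose_two_add, sq_eq_choose_two k, h3]
        ring
      · simp only [evenExtend_odd]
        ring
    rw [Finset.sum_congr rfl h1, ← Finset.mul_sum, sum_evenExtend_div_qPoch hq, eulerTerm,
      sq_eq_choose_two]
    ring

/-- In `R(t) - R(tq)` the factor `1 - q^k` cancels against `(q; q)_k`, and the index shifts by one.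
-/
theorem rrR_sub_mul_rrR {q : ℂ} (hq : ‖q‖ < 1) (t : ℂ) :
    rrR t q = rrR (t * q) q + t * q * rrR (t * q ^ 2) q := by
  have hs := summable_rrR hq t
  have hs' := summable_rrR hq (t * q)
  have key : ∑' k : ℕ, (q ^ (k ^ 2) * t ^ k / qPoch q q k -
      q ^ (k ^ 2) * (t * q) ^ k / qPoch q q k) = t * q * rrR (t * q ^ 2) q := by
    rw [(hs.sub hs').tsum_eq_zero_add, rrR, ← tsum_mul_left]
    simp only [pow_zero, sub_self, zero_add]
    refine tsum_congr fun n => ?_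
    have h1 := qPoch_ne_zero hq hq n
    have h2 : 1 - q * q ^ n ≠ 0 :=
      one_sub_ne_zero_of_norm_lt_one (norm_mul_pow_lt_one hq hq n)
    rw [qPoch_succ]
    field_simp
    ring
  rw [hs.tsum_sub hs'] at key
  simp only [rrR] at key ⊢
  linear_combination key

/-- Odd and even powers in `(-q; q)_{2k}` give `(-q; q²)_k (-q²; q²)_k`, and `(q²; q²)_k (-q²; q²)_k
= (q⁴; q⁴)_k`. -/
theorem qPoch_sq_mul_qPoch_neg (q : ℂ) (k : ℕ) :
    qPoch (q ^ 4) (q ^ 4) k * qPoch (-q) (q ^ 2) k =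
      qPoch (q ^ 2) (q ^ 2) k * qPoch (-q) q (2 * k) := by
  induction k with
  | zero => simp [qPoch_zero]
  | succ k ih =>
    rw [show 2 * (k + 1) = 2 * k + 1 + 1 by ring, qPoch_succ, qPoch_succ, qPoch_succ, qPoch_succ,
      qPoch_succ]
    linear_combination (1 - q ^ 4 * (q ^ 4) ^ k) * (1 - -q * (q ^ 2) ^ k) * ih

theorem qPoch_sq_mul_qPoch_neg_succ (q : ℂ) (k : ℕ) :
    qPoch (q ^ 4) (q ^ 4) k * qPoch (-q) (q ^ 2) (k + 1) =
      qPoch (q ^ 2) (q ^ 2) k * qPoch (-q) q (2 * k + 1) := by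
  rw [qPoch_succ, qPoch_succ, ← mul_assoc, qPoch_sq_mul_qPoch_neg]
  ring

theorem hasSum_rrH_neg_succ {q : ℂ} (hq : ‖q‖ < 1) :
    HasSum (fun k : ℕ => qPochInf (-q) q * ((-1) ^ k * q ^ (k * (3 * k + 2)) /
        (qPoch (q ^ 4) (q ^ 4) k * qPoch (-q) (q ^ 2) (k + 1)))) (rrH q) := by
  unfold rrH
  convert hasSum_rrR hq q using 1
  funext k
  have h1 := qPoch_ne_zero (norm_pow_lt_one hq two_ne_zero) (norm_pow_lt_one hq two_ne_zero) k
  have h2 := qPoch_ne_zero (a := -q) (by rwa [norm_neg]) hq (2 * k + 1)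
  rw [qPoch_sq_mul_qPoch_neg_succ, qPochInf_eq_mul (-q) hq (2 * k + 1), neg_mul]
  field_simp
  ring

theorem hasSum_rrH_neg {q : ℂ} (hq : ‖q‖ < 1) :
    HasSum (fun k : ℕ => qPochInf (-q) q * ((-1) ^ k * q ^ (k * (3 * k - 2)) /
        (qPoch (q ^ 4) (q ^ 4) k * qPoch (-q) (q ^ 2) k))) (rrH q) := by
  have hq2 := norm_pow_lt_one hq two_ne_zero
  have hR : rrH q = rrR 1 q + -(q * rrR (q ^ 2) q) := by
    have := rrR_sub_mul_rrR hq 1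
    simp only [one_mul] at this
    rw [rrH, this]
    ring
  have hA := hasSum_rrR hq 1
  have hB := ((hasSum_rrR hq (q ^ 2)).mul_left q).neg
  -- `u` is the series for `-q R(q²)` shifted by one, with `u 0 = 0` thanks to `1 - q^{2k}`. Adding
  -- the series for `R(1)` then works termwise: `q^{3k²} + q^{3k²-2k} (1 - q^{2k}) = q^{3k²-2k}`.
  set u : ℕ → ℂ := fun k => (-1) ^ k * q ^ (k * (3 * k - 2)) * (1 - q ^ (2 * k)) /
    qPoch (q ^ 2) (q ^ 2) k * qPochInf (-q ^ (2 * k + 1)) q with hu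
  have hB' : HasSum u (-(q * rrR (q ^ 2) q)) := by
    refine ((hasSum_nat_add_iff' 1).1 ?_)
    simp only [Finset.range_one, Finset.sum_singleton]
    convert hB using 1
    · funext k
      have h1 := qPoch_ne_zero hq2 hq2 k
      have h2 : 1 - q ^ 2 * (q ^ 2) ^ k ≠ 0 :=
        one_sub_ne_zero_of_norm_lt_one (norm_mul_pow_lt_one hq2 hq2 k)
      have h3 : -(q ^ 2 * q ^ (2 * k + 1)) = -q ^ (2 * (k + 1) + 1) := by ring
      have h4 : (k + 1) * (3 * (k + 1) - 2) = 3 * k ^ 2 + 4 * k + 1 := by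
        rw [show 3 * (k + 1) - 2 = 3 * k + 1 by omega]; ring
      rw [hu, h3]
      simp only [h4, qPoch_succ]
      generalize qPochInf (-q ^ (2 * (k + 1) + 1)) q = P
      field_simp
      ring
    · simp [hu]
  rw [hR]
  convert hA.add hB' using 1
  funext k
  have h1 := qPoch_ne_zero hq2 hq2 k
  have h2 := qPoch_ne_zero (a := -q) (by rwa [norm_neg]) hq (2 * k)
  have h3 : 3 * k ^ 2 = k * (3 * k - 2) + 2 * k := by
    rcases k with _ | k
    · rfl
    · rw [show 3 * (k + 1) - 2 = 3 * k + 1 by omega]; ring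
  rw [qPoch_sq_mul_qPoch_neg, qPochInf_eq_mul (-q) hq (2 * k), h3,
    show -q * q ^ (2 * k) = -q ^ (2 * k + 1) by ring,
    show -(1 * q ^ (2 * k + 1)) = -q ^ (2 * k + 1) by ring]
  simp only [hu]
  generalize qPochInf (-q ^ (2 * k + 1)) q = P
  simp only [one_pow, mul_one, pow_add]
  generalize q ^ (k * (3 * k - 2)) = E
  field_simp
  ring

theorem hasSum_rrH_sq {p : ℂ} (hp : ‖p‖ < 1) :
    HasSum (fun k : ℕ => qPochInf p (p ^ 2) * (p ^ (3 * k.choose 2 + 4 * k) /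
        (qPoch p p k * qPoch p (p ^ 2) (k + 2)))) (rrH (p ^ 2)) := by
  have hp2 := norm_pow_lt_one hp two_ne_zero
  have hb : Summable fun k : ℕ => ‖p ^ (3 * k.choose 2 + 4 * k) / qPoch p p k‖ := by
    refine (summable_norm_div_qPoch hp hp (norm_pow_lt_one hp three_ne_zero) (p ^ 4)).congr
      fun k => ?_
    congr 2
    ring
  -- The choice `y = -p⁵` makes the tail `(p^{2k+5}; p²)_∞`, which is `(p; p²)_∞ / (p; p²)_{k+2}`.
  convert hasSum_mul_qPochInf hp2 (-p ^ 5) hb using 1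
  · funext k
    have h1 := qPoch_ne_zero hp hp k
    have h2 := qPoch_ne_zero hp hp2 (k + 2)
    rw [qPochInf_eq_mul p hp2 (k + 2),
      show -(-p ^ 5 * (p ^ 2) ^ k) = p * (p ^ 2) ^ (k + 2) by ring]
    field_simp
  · refine tsum_congr fun n => ?_
    have h1 : ∀ x ∈ Finset.HasAntidiagonal.antidiagonal n,
        p ^ (3 * x.1.choose 2 + 4 * x.1) / qPoch p p x.1 *
          eulerTerm (p ^ 2) (-p ^ 5 * (p ^ 2) ^ x.1) x.2 =
        p ^ (2 * n.choose 2 + 4 * n) *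
          (eulerTerm p 1 x.1 * ((-p) ^ x.2 / qPoch (p ^ 2) (p ^ 2) x.2)) := by
      rintro ⟨k, m⟩ hx
      obtain rfl : k + m = n := by simpa using hx
      simp only [eulerTerm, choose_two_add]
      rw [mul_pow, neg_pow (p ^ 5), neg_pow p]
      ring
    rw [Finset.sum_congr rfl h1, ← Finset.mul_sum, sum_eulerTerm_mul_div_qPoch hp, eulerTerm,
      sq_eq_choose_two]
    ring

/-! ### Rogers' recurrence and the theta series for `(q; q)_∞ H(q)` -/

theorem norm_pow_mul_le {q : ℂ} (hq : ‖q‖ < 1) {e r : ℕ} (he : r.choose 2 ≤ e) {z : ℂ} {B : ℝ}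
    (hz : ‖z‖ ≤ B) : ‖q ^ e * z‖ ≤ B * ‖q ^ r.choose 2 * 1 ^ r‖ := by
  rw [norm_mul, one_pow, mul_one, mul_comm, norm_pow, norm_pow]
  exact mul_le_mul hz (pow_le_pow_of_le_one (norm_nonneg _) hq.le he) (by positivity)
    ((norm_nonneg _).trans hz)

/-- The terms of the auxiliary series in Rogers' proof. -/
noncomputable def rogersTerm (q : ℂ) (n s r : ℕ) : ℂ :=
  q ^ (5 * r.choose 2 + 2 * r * (n + 1) + s * r) *
    ((-1) ^ r * (qPoch q q (n + r) / qPoch q q r))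

theorem exists_norm_rogersTerm_le {q : ℂ} (hq : ‖q‖ < 1) :
    ∃ C, 0 < C ∧ ∀ n s r, ‖rogersTerm q n s r‖ ≤ C * ‖q ^ r.choose 2 * 1 ^ r‖ := by
  obtain ⟨C, hC, h⟩ := exists_norm_qPoch_inv_le hq hq
  obtain ⟨C', hC', h'⟩ := exists_norm_qPoch_le q hq
  refine ⟨C' * C, mul_pos hC' hC, fun n s r => norm_pow_mul_le hq (by nlinarith) ?_⟩
  rw [norm_mul, norm_pow, norm_neg, norm_one, one_pow, one_mul, div_eq_mul_inv, norm_mul]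
  exact mul_le_mul (h' _) (h _) (norm_nonneg _) hC'.le

theorem summable_rogersTerm {q : ℂ} (hq : ‖q‖ < 1) (n s : ℕ) :
    Summable (rogersTerm q n s) := by
  obtain ⟨C, -, h⟩ := exists_norm_rogersTerm_le hq
  exact (summable_norm_of_le_choose_two hq 1 C (h n s)).of_norm

noncomputable def rogersSum (q : ℂ) (n s : ℕ) : ℂ := ∑' r, rogersTerm q n s r

/-- Split off the last factor `1 - q^{n+r+1}` of `(q; q)_{n+1+r}`; each factor `q^r` raises `s` by
one. -/
theorem rogersSum_succ {q : ℂ} (hq : ‖q‖ < 1) (n s : ℕ) :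
    rogersSum q (n + 1) s = rogersSum q n (s + 2) - q ^ (n + 1) * rogersSum q n (s + 3) := by
  rw [rogersSum, rogersSum, rogersSum, ← tsum_mul_left,
    ← (summable_rogersTerm hq n _).tsum_sub ((summable_rogersTerm hq n _).mul_left _)]
  refine tsum_congr fun r => ?_
  rw [rogersTerm, rogersTerm, rogersTerm, show n + 1 + r = n + r + 1 by ring, qPoch_succ]
  ring

theorem rogersSum_sub {q : ℂ} (hq : ‖q‖ < 1) (n s : ℕ) :
    rogersSum q n s - rogersSum q n (s + 1) = -(q ^ (2 * (n + 1) + s)) *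
      (rogersSum q n (s + 5) - q ^ (n + 1) * rogersSum q n (s + 6)) := by
  have hs := fun s => summable_rogersTerm hq n s
  simp only [rogersSum]
  rw [← (hs _).tsum_sub (hs _), ← tsum_mul_left, ← (hs _).tsum_sub ((hs _).mul_left _),
    ← tsum_mul_left, ((hs _).sub (hs _)).tsum_eq_zero_add]
  simp only [rogersTerm, mul_zero, sub_self, zero_add]
  refine tsum_congr fun r => ?_
  have h1 := qPoch_ne_zero hq hq r
  have h2 : 1 - q * q ^ r ≠ 0 :=
    one_sub_ne_zero_of_norm_lt_one (norm_mul_pow_lt_one hq hq r)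
  rw [show n + (r + 1) = n + r + 1 by ring, qPoch_succ, qPoch_succ, choose_two_succ]
  field_simp
  ring

theorem tendsto_rogersSum {q : ℂ} (hq : ‖q‖ < 1) (s : ℕ) :
    Tendsto (fun n => rogersSum q n s) atTop (𝓝 (qPochInf q q)) := by
  obtain ⟨C, hC, hle⟩ := exists_norm_rogersTerm_le hq
  rw [← tsum_ite_eq (0 : ℕ) (fun _ => qPochInf q q)]
  refine tendsto_tsum_of_dominated_convergence
    ((summable_norm_pow_choose_two_mul_pow hq 1).mul_left C) (fun r => ?_)
    (Eventually.of_forall fun n r => hle n s r)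
  rcases r with _ | r
  · simpa [rogersTerm, qPoch_zero] using tendsto_qPoch q hq
  · have h1 : Tendsto (fun n => qPoch q q (n + (r + 1))) atTop (𝓝 (qPochInf q q)) :=
      (tendsto_add_atTop_iff_nat (r + 1)).2 (tendsto_qPoch q hq)
    have h2 : Tendsto (fun n : ℕ => (q ^ (2 * (r + 1))) ^ (n + 1)) atTop (𝓝 0) :=
      (tendsto_add_atTop_iff_nat 1).2
        (tendsto_pow_atTop_nhds_zero_of_norm_lt_one (norm_pow_lt_one hq (by omega)))
    have h3 := (h2.mul h1).mul_const
      (q ^ (5 * (r + 1).choose 2 + s * (r + 1)) * (-1) ^ (r + 1) / qPoch q q (r + 1))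
    simp only [zero_mul] at h3
    rw [if_neg (Nat.succ_ne_zero r)]
    refine h3.congr fun n => ?_
    rw [rogersTerm]
    ring

/-- A solution of the Rogers–Ramanujan recurrence that tends to `0` vanishes. -/
theorem eq_zero_of_recurrence {q : ℂ} (hq : ‖q‖ < 1) {u : ℕ → ℂ}
    (hu : ∀ n, u n = u (n + 1) + q ^ (n + 1) * u (n + 2)) (h0 : Tendsto u atTop (𝓝 0)) (n : ℕ) :
    u n = 0 := by
  set M : ℕ → ℝ := fun n => max ‖u n‖ ‖u (n + 1)‖ with hM
  set P : ℕ → ℝ := fun n => ∏ j ∈ Finset.range n, (1 + ‖q‖ ^ (j + 1)) with hP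
  have hP1 : ∀ n, 0 < P n := fun n => Finset.prod_pos fun j _ => by positivity
  have hmul : Multipliable fun j : ℕ => 1 + ‖q‖ ^ (j + 1) := by
    refine multipliable_one_add_of_summable ?_
    simp only [norm_pow, norm_norm]
    exact (summable_nat_add_iff 1).2 (summable_geometric_of_lt_one (norm_nonneg q) hq)
  have hPt : Tendsto P atTop (𝓝 (∏' j : ℕ, (1 + ‖q‖ ^ (j + 1)))) := hmul.hasProd.tendsto_prod_nat
  have hMt : Tendsto M atTop (𝓝 0) := by
    have h1 := h0.norm
    have h2 := (tendsto_add_atTop_iff_nat 1).2 h1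
    simpa using h1.max h2
  -- The recurrence gives `M n ≤ (1 + |q|^{n+1}) M (n+1)`. Since `P` converges, the increasing
  -- sequence `P n * M n` tends to `0`, hence is never positive.
  have hmono : Monotone fun n => P n * M n := by
    refine monotone_nat_of_le_succ fun n => ?_
    have h1 : M n ≤ (1 + ‖q‖ ^ (n + 1)) * M (n + 1) := by
      have h2 : ‖u (n + 1)‖ ≤ M (n + 1) := le_max_left _ _
      have h3 : ‖u (n + 2)‖ ≤ M (n + 1) := le_max_right _ _
      have h4 : 0 ≤ ‖q‖ ^ (n + 1) := by positivity
      have h5 : 0 ≤ M (n + 1) := (norm_nonneg _).trans h2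
      refine max_le ?_ (by nlinarith)
      rw [hu n]
      refine (norm_add_le _ _).trans ?_
      rw [norm_mul, norm_pow]
      nlinarith
    calc P n * M n ≤ P n * ((1 + ‖q‖ ^ (n + 1)) * M (n + 1)) :=
          mul_le_mul_of_nonneg_left h1 (hP1 n).le
      _ = P (n + 1) * M (n + 1) := by rw [hP]; simp only [Finset.prod_range_succ]; ring
  have hle := hmono.ge_of_tendsto (hPt.mul hMt) n
  rw [mul_zero] at hle
  have h1 : M n ≤ 0 := by
    by_contra! h
    exact absurd hle (not_le.2 (mul_pos (hP1 n) h))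
  exact norm_le_zero_iff.1 ((le_max_left _ _).trans h1)

theorem tendsto_rrR_pow {q : ℂ} (hq : ‖q‖ < 1) :
    Tendsto (fun n => rrR (q ^ n) q) atTop (𝓝 1) := by
  obtain ⟨C, hC, h⟩ := exists_norm_qPoch_inv_le hq hq
  rw [← tsum_ite_eq (0 : ℕ) (fun _ => (1 : ℂ))]
  refine tendsto_tsum_of_dominated_convergence
    ((summable_norm_pow_choose_two_mul_pow hq 1).mul_left C) (fun r => ?_)
    (Eventually.of_forall fun n r => ?_)
  · rcases r with _ | r
    · simp [qPoch_zero]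
    · have h1 := tendsto_pow_atTop_nhds_zero_of_norm_lt_one
        (norm_pow_lt_one hq r.add_one_ne_zero)
      have h2 := h1.mul_const (q ^ (r + 1) ^ 2 / qPoch q q (r + 1))
      rw [zero_mul] at h2
      rw [if_neg (Nat.succ_ne_zero r)]
      refine h2.congr fun n => ?_
      rw [← pow_mul, ← pow_mul, mul_comm n]
      ring
  · have h1 : q ^ (r ^ 2) * (q ^ n) ^ r / qPoch q q r =
        q ^ (r ^ 2 + n * r) * (qPoch q q r)⁻¹ := by ring
    rw [h1]
    exact norm_pow_mul_le hq (by rw [sq_eq_choose_two]; omega) (h r)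

theorem qPochInf_mul_rrH {q : ℂ} (hq : ‖q‖ < 1) :
    qPochInf q q * rrH q = rogersSum q 0 2 - q * rogersSum q 0 4 := by
  set V : ℕ → ℂ := fun n => rogersSum q n 1 - q ^ (2 * (n + 1)) * rogersSum q n 5 with hV
  set U : ℕ → ℂ := fun n => rogersSum q n 2 - q ^ (n + 1) * rogersSum q n 4 with hU
  have hUV : ∀ n, U n = V (n + 1) := fun n => by
    simp only [hU, hV, rogersSum_succ hq]
    linear_combination rogersSum_sub hq n 2
  have hVU : ∀ n, V n = U n + q ^ (n + 1) * U (n + 1) := fun n => by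
    simp only [hU, hV, rogersSum_succ hq]
    linear_combination rogersSum_sub hq n 1
  have hVt : Tendsto V atTop (𝓝 (qPochInf q q)) := by
    have h1 : Tendsto (fun n : ℕ => q ^ (2 * (n + 1))) atTop (𝓝 0) := by
      simp only [pow_mul]
      exact (tendsto_add_atTop_iff_nat 1).2
        (tendsto_pow_atTop_nhds_zero_of_norm_lt_one (norm_pow_lt_one hq two_ne_zero))
    simpa using (tendsto_rogersSum hq 1).sub (h1.mul (tendsto_rogersSum hq 5))
  -- `hUV` and `hVU` give `V n = V (n+1) + q^{n+1} V (n+2)`, the recurrence of `R(q^n; q)`. The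
  -- factor `(q; q)_∞` matches the limits, and index `1` yields `H(q)` because `V 1 = U 0`.
  have h := eq_zero_of_recurrence hq (u := fun n => V n - qPochInf q q * rrR (q ^ n) q)
    (fun n => by
      have h1 := rrR_sub_mul_rrR hq (q ^ n)
      rw [show q ^ n * q = q ^ (n + 1) by ring, show q ^ n * q ^ 2 = q ^ (n + 2) by ring] at h1
      rw [h1, hVU, hUV, hUV]
      ring)
    (by simpa using hVt.sub ((tendsto_rrR_pow hq).const_mul (qPochInf q q))) 1
  simp only [pow_one, ← hUV 0] at h
  rw [rrH, ← sub_eq_zero.1 h, hU]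
  simp

/-! ### Durfee rectangles and the Jacobi triple product -/

noncomputable def durfeeTerm (q : ℂ) (e d n : ℕ) : ℂ :=
  q ^ (n ^ 2 + n * e) * ((qPoch q q n)⁻¹ * (qPoch q q (n + d))⁻¹)

theorem exists_norm_durfeeTerm_le {q : ℂ} (hq : ‖q‖ < 1) :
    ∃ C, 0 < C ∧ ∀ e d n, ‖durfeeTerm q e d n‖ ≤ C * ‖q ^ n.choose 2 * 1 ^ n‖ := by
  obtain ⟨C, hC, h⟩ := exists_norm_qPoch_inv_le hq hq
  refine ⟨C * C, mul_pos hC hC, fun e d n =>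
    norm_pow_mul_le hq (by rw [sq_eq_choose_two]; omega) ?_⟩
  rw [norm_mul]
  exact mul_le_mul (h _) (h _) (norm_nonneg _) hC.le

theorem summable_durfeeTerm {q : ℂ} (hq : ‖q‖ < 1) (e d : ℕ) :
    Summable (durfeeTerm q e d) := by
  obtain ⟨C, -, h⟩ := exists_norm_durfeeTerm_le hq
  exact (summable_norm_of_le_choose_two hq 1 C (h e d)).of_norm

theorem tsum_durfeeTerm_eq_sub {q : ℂ} (hq : ‖q‖ < 1) (e d : ℕ) :
    ∑' n, durfeeTerm q e d n = ∑' n, durfeeTerm q e (d + 1) n -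
      q ^ (d + 1) * ∑' n, durfeeTerm q (e + 1) (d + 1) n := by
  rw [← tsum_mul_left, ← (summable_durfeeTerm hq _ _).tsum_sub
    ((summable_durfeeTerm hq _ _).mul_left _)]
  refine tsum_congr fun n => ?_
  have h1 := qPoch_ne_zero hq hq n
  have h2 := qPoch_ne_zero hq hq (n + d)
  have h3 : 1 - q * q ^ (n + d) ≠ 0 :=
    one_sub_ne_zero_of_norm_lt_one (norm_mul_pow_lt_one hq hq _)
  rw [durfeeTerm, durfeeTerm, durfeeTerm, ← add_assoc, qPoch_succ]
  field_simp
  ring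

theorem tsum_durfeeTerm_sub {q : ℂ} (hq : ‖q‖ < 1) (e d : ℕ) :
    ∑' n, durfeeTerm q e d n - ∑' n, durfeeTerm q (e + 1) d n =
      q ^ (e + 1) * ∑' n, durfeeTerm q (e + 2) (d + 1) n := by
  have hs := fun e d => summable_durfeeTerm hq e d
  rw [← tsum_mul_left, ← (hs _ _).tsum_sub (hs _ _), ((hs _ _).sub (hs _ _)).tsum_eq_zero_add]
  simp only [durfeeTerm, zero_mul, sub_self, zero_add]
  refine tsum_congr fun n => ?_
  have h1 := qPoch_ne_zero hq hq n
  have h2 : 1 - q * q ^ n ≠ 0 :=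
    one_sub_ne_zero_of_norm_lt_one (norm_mul_pow_lt_one hq hq n)
  rw [show n + 1 + d = n + (d + 1) by ring, qPoch_succ]
  generalize (qPoch q q (n + (d + 1)))⁻¹ = P
  field_simp
  ring

theorem tendsto_tsum_durfeeTerm {q : ℂ} (hq : ‖q‖ < 1) :
    Tendsto (fun d => ∑' n, durfeeTerm q d d n) atTop (𝓝 (qPochInf q q)⁻¹) := by
  obtain ⟨C, hC, hle⟩ := exists_norm_durfeeTerm_le hq
  rw [← tsum_ite_eq (0 : ℕ) (fun _ => (qPochInf q q)⁻¹)]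
  have hinv := (tendsto_qPoch q hq).inv₀ (qPochInf_ne_zero hq hq)
  refine tendsto_tsum_of_dominated_convergence
    ((summable_norm_pow_choose_two_mul_pow hq 1).mul_left C) (fun n => ?_)
    (Eventually.of_forall fun d n => hle d d n)
  rcases n with _ | n
  · simpa [durfeeTerm, qPoch_zero] using hinv
  · have h1 : Tendsto (fun d => (qPoch q q (d + (n + 1)))⁻¹) atTop (𝓝 (qPochInf q q)⁻¹) :=
      (tendsto_add_atTop_iff_nat (n + 1)).2 hinv
    have h2 := tendsto_pow_atTop_nhds_zero_of_norm_lt_one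
      (norm_pow_lt_one hq n.add_one_ne_zero)
    have h3 := (h2.mul h1).mul_const (q ^ (n + 1) ^ 2 * (qPoch q q (n + 1))⁻¹)
    simp only [zero_mul] at h3
    rw [if_neg (Nat.succ_ne_zero n)]
    refine h3.congr fun d => ?_
    rw [durfeeTerm, add_comm d]
    ring

/-- Cauchy's Durfee rectangle identity. -/
theorem tsum_durfeeTerm {q : ℂ} (hq : ‖q‖ < 1) (d : ℕ) :
    ∑' n, durfeeTerm q d d n = (qPochInf q q)⁻¹ := by
  set D : ℕ → ℂ := fun d => ∑' n, durfeeTerm q d d n with hD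
  have ht : Tendsto D atTop (𝓝 (qPochInf q q)⁻¹) := tendsto_tsum_durfeeTerm hq
  have hrec : ∀ d, D d - D (d + 1) = -q ^ (d + 1) * (D (d + 1) - D (d + 2)) := fun d => by
    have h1 := tsum_durfeeTerm_eq_sub hq d d
    have h2 := tsum_durfeeTerm_sub hq d (d + 1)
    simp only [hD]
    linear_combination h1 + h2
  -- Consecutive differences of `D` grow in norm with `d` yet tend to `0`, so they vanish and `D`
  -- equals its limit.
  have hmono : Monotone fun d => ‖D d - D (d + 1)‖ := by
    refine monotone_nat_of_le_succ fun d => ?_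
    rw [hrec d, norm_mul, norm_neg, norm_pow]
    exact mul_le_of_le_one_left (norm_nonneg _) (pow_le_one₀ (norm_nonneg _) hq.le)
  have hlim : Tendsto (fun d => ‖D d - D (d + 1)‖) atTop (𝓝 0) := by
    simpa using (ht.sub ((tendsto_add_atTop_iff_nat 1).2 ht)).norm
  have hstep : ∀ d, D d = D (d + 1) := fun d =>
    sub_eq_zero.1 (norm_le_zero_iff.1 (hmono.ge_of_tendsto hlim d))
  have hconst : ∀ n, D n = D 0 := fun n => by
    induction n with
    | zero => rfl
    | succ n ih => rw [← hstep, ih]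
  have h0 : D 0 = (qPochInf q q)⁻¹ :=
    tendsto_nhds_unique (tendsto_const_nhds.congr fun n => (hconst n).symm) ht
  change D d = _
  rw [hconst, h0]

/-- Pairs of naturals sorted by the sign of the difference of their entries. -/
def diffSplit : (ℕ × ℕ) ⊕ (ℕ × ℕ) → ℕ × ℕ :=
  Sum.elim (fun x => (x.2 + x.1, x.2)) (fun x => (x.2, x.2 + (x.1 + 1)))

theorem diffSplit_bijective : Function.Bijective diffSplit := by
  constructor
  · rintro (⟨a, b⟩ | ⟨a, b⟩) (⟨c, d⟩ | ⟨c, d⟩) h <;>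
      simp only [diffSplit, Sum.elim_inl, Sum.elim_inr, Prod.mk.injEq, Sum.inl.injEq,
        Sum.inr.injEq, reduceCtorEq] at h ⊢ <;> omega
  · rintro ⟨m, n⟩
    rcases le_or_gt n m with h | h
    · exact ⟨Sum.inl (m - n, n), by simp [diffSplit, h]⟩
    · refine ⟨Sum.inr (n - m - 1, m), ?_⟩
      simp only [diffSplit, Sum.elim_inr, Prod.mk.injEq, true_and]
      omega

theorem tsum_prod_eq_tsum_diff {f : ℕ × ℕ → ℂ} (hf : Summable f) :
    ∑' z, f z = ∑' d, ∑' n, f (n + d, n) + ∑' d, ∑' n, f (n, n + (d + 1)) := by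
  have hf' := (Equiv.ofBijective _ diffSplit_bijective).summable_iff.2 hf
  have hl : Summable fun z : ℕ × ℕ => f (z.2 + z.1, z.2) := hf'.comp_injective Sum.inl_injective
  have hr : Summable fun z : ℕ × ℕ => f (z.2, z.2 + (z.1 + 1)) :=
    hf'.comp_injective Sum.inr_injective
  rw [← hl.tsum_prod, ← hr.tsum_prod, ← (Equiv.ofBijective _ diffSplit_bijective).tsum_eq]
  exact Summable.tsum_sum (f := fun z => f (diffSplit z)) hl hr

/-- On a diagonal of fixed difference `d`, the product of two Euler series reduces to a multiple of
the Durfee sum, which is `1 / (q; q)_∞` for every `d`. -/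
theorem eulerTerm_mul_eulerTerm (x y : ℂ) (d n : ℕ) :
    eulerTerm (x * y) (-x) (n + d) * eulerTerm (x * y) (-y) n =
      (x * y) ^ d.choose 2 * (-x) ^ d * durfeeTerm (x * y) d d n := by
  rw [eulerTerm, eulerTerm, durfeeTerm, choose_two_add, sq_eq_choose_two, pow_add (-x), div_mul_div_comm,
    div_eq_mul_inv, mul_inv]
  have : (-x) ^ n * (-y) ^ n = (x * y) ^ n := by rw [← mul_pow]; ring
  rw [pow_add (x * y) (_ + n), pow_add (x * y) _ n, ← this]
  ring

/-- The Jacobi triple product identity. -/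
theorem jacobi_triple_product {x y : ℂ} (hq : ‖x * y‖ < 1) :
    qPochInf (x * y) (x * y) * (qPochInf x (x * y) * qPochInf y (x * y)) =
      ∑' d : ℕ, (x * y) ^ d.choose 2 * (-x) ^ d +
        ∑' d : ℕ, (x * y) ^ (d + 1).choose 2 * (-y) ^ (d + 1) := by
  have hx := summable_norm_eulerTerm hq (-x)
  have hy := summable_norm_eulerTerm hq (-y)
  have hs : Summable fun z : ℕ × ℕ => eulerTerm (x * y) (-x) z.1 * eulerTerm (x * y) (-y) z.2 :=
    summable_mul_of_summable_norm hx hy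
  have h3 := tsum_mul_tsum_of_summable_norm hx hy
  rw [tsum_eulerTerm hq, tsum_eulerTerm hq, neg_neg, neg_neg] at h3
  have hP := qPochInf_ne_zero hq hq
  rw [h3, tsum_prod_eq_tsum_diff hs]
  have e1 : ∀ d n, eulerTerm (x * y) (-x) n * eulerTerm (x * y) (-y) (n + (d + 1)) =
      (x * y) ^ (d + 1).choose 2 * (-y) ^ (d + 1) * durfeeTerm (x * y) (d + 1) (d + 1) n :=
    fun d n => by rw [mul_comm, mul_comm x y, eulerTerm_mul_eulerTerm]
  simp only [eulerTerm_mul_eulerTerm, e1, tsum_mul_left, tsum_durfeeTerm hq, tsum_mul_right]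
  field_simp

/-! ### The second Rogers–Ramanujan identity and the conclusion -/

theorem qPoch_five_mul (q : ℂ) (n : ℕ) :
    qPoch q q (5 * n) = qPoch (q ^ 5) (q ^ 5) n *
      (qPoch (q ^ 4) (q ^ 5) n * qPoch q (q ^ 5) n) *
      (qPoch (q ^ 2) (q ^ 5) n * qPoch (q ^ 3) (q ^ 5) n) := by
  induction n with
  | zero => simp [qPoch_zero]
  | succ n ih =>
    rw [show 5 * (n + 1) = 5 * n + 1 + 1 + 1 + 1 + 1 by ring]
    simp only [qPoch_succ]
    rw [ih]
    ring

theorem qPochInf_eq_prod_five {q : ℂ} (hq : ‖q‖ < 1) :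
    qPochInf q q = qPochInf (q ^ 5) (q ^ 5) *
      (qPochInf (q ^ 4) (q ^ 5) * qPochInf q (q ^ 5)) *
      (qPochInf (q ^ 2) (q ^ 5) * qPochInf (q ^ 3) (q ^ 5)) := by
  have h5 := norm_pow_lt_one hq (show 5 ≠ 0 by norm_num)
  have ht := fun a => tendsto_qPoch a h5
  have h1 : Tendsto (fun n => qPoch q q (5 * n)) atTop (𝓝 (qPochInf q q)) :=
    (tendsto_qPoch q hq).comp (tendsto_id.const_mul_atTop' (by norm_num))
  refine tendsto_nhds_unique h1 ?_
  simp only [qPoch_five_mul]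
  exact ((ht _).mul ((ht _).mul (ht _))).mul ((ht _).mul (ht _))

/-- The second Rogers–Ramanujan identity. -/
theorem rrH_eq {q : ℂ} (hq : ‖q‖ < 1) :
    rrH q = 1 / (qPochInf (q ^ 2) (q ^ 5) * qPochInf (q ^ 3) (q ^ 5)) := by
  have h5 := norm_pow_lt_one hq (show 5 ≠ 0 by norm_num)
  have hx : q ^ 4 * q = q ^ 5 := by ring
  have hJ := jacobi_triple_product (x := q ^ 4) (y := q) (by rwa [hx])
  have hR := qPochInf_mul_rrH hq
  -- At `n = 0` the quotient of factorials in `rogersTerm` is `1`, leaving the two halves of the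
  -- theta series with `x = q⁴`, `y = q`.
  have hS : rogersSum q 0 2 - q * rogersSum q 0 4 =
      ∑' d : ℕ, (q ^ 4 * q) ^ d.choose 2 * (-q ^ 4) ^ d +
        ∑' d : ℕ, (q ^ 4 * q) ^ (d + 1).choose 2 * (-q) ^ (d + 1) := by
    rw [sub_eq_add_neg, ← neg_mul, rogersSum, rogersSum, ← tsum_mul_left]
    congr 1 <;> refine tsum_congr fun r => ?_
    · rw [rogersTerm, zero_add, zero_add, div_self (qPoch_ne_zero hq hq r), neg_pow (q ^ 4)]
      ring
    · rw [rogersTerm, zero_add, zero_add, div_self (qPoch_ne_zero hq hq r), neg_pow q, choose_two_succ]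
      ring
  rw [hS, ← hJ, hx, qPochInf_eq_prod_five hq] at hR
  have hne : ∀ i, i ≠ 0 → qPochInf (q ^ i) (q ^ 5) ≠ 0 := fun i hi =>
    qPochInf_ne_zero (norm_pow_lt_one hq hi) h5
  have h1 := hne 1 (by norm_num)
  rw [pow_one] at h1
  have h2 := hne 2 (by norm_num)
  have h3 := hne 3 (by norm_num)
  have h23 := mul_ne_zero h2 h3
  have hA := mul_ne_zero (hne 5 (by norm_num)) (mul_ne_zero (hne 4 (by norm_num)) h1)
  rw [eq_div_iff h23]
  refine mul_left_cancel₀ hA ?_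
  linear_combination hR

theorem exists_hasSum_of_hasSum_mul {f : ℕ → ℂ} {P H Z : ℂ} (hP : P ≠ 0)
    (h : HasSum (fun k => P * f k) H) (hH : H = 1 / Z) :
    ∃ S : ℂ, HasSum f S ∧ H = P * S ∧ S = 1 / (P * Z) := by
  refine ⟨P⁻¹ * H, ?_, by rw [mul_inv_cancel_left₀ hP], by rw [hH, one_div, one_div, mul_inv]⟩
  have h' := h.mul_left P⁻¹
  simp only [inv_mul_cancel_left₀ hP] at h'
  exact h'

theorem mainTheorem6 (q r : ℂ) (hq : ‖q‖ < 1) (hr : r ^ 4 = q) :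
    -- `r` is a fourth root `q^{1/4}`, and `r ^ 2` is the corresponding `q^{1/2}`
    -- the series `H(q)` converges, and its product formula
    Summable (fun k : ℕ => q ^ (k ^ 2) * q ^ k / qPoch q q k) ∧
    rrH q = 1 / (qPochInf (q ^ 2) (q ^ 5) * qPochInf (q ^ 3) (q ^ 5)) ∧
    -- the series with `q^{k(3k+5)/4}`
    (∃ S : ℂ,
      HasSum (fun k : ℕ => r ^ (k * (3 * k + 5)) /
        (qPoch (r ^ 2) (r ^ 2) k * qPoch (r ^ 2) q (k + 2))) S ∧
      rrH q = qPochInf (r ^ 2) q * S ∧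
      S = 1 / (qPochInf (r ^ 2) q *
        (qPochInf (q ^ 2) (q ^ 5) * qPochInf (q ^ 3) (q ^ 5)))) ∧
    -- the series with `q^{k(3k+2)}`
    (∃ S : ℂ,
      HasSum (fun k : ℕ => (-1) ^ k * q ^ (k * (3 * k + 2)) /
        (qPoch (q ^ 4) (q ^ 4) k * qPoch (-q) (q ^ 2) (k + 1))) S ∧
      rrH q = qPochInf (-q) q * S ∧
      S = 1 / (qPochInf (-q) q *
        (qPochInf (q ^ 2) (q ^ 5) * qPochInf (q ^ 3) (q ^ 5)))) ∧
    -- the series with `q^{k(3k-2)}`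
    (∃ S : ℂ,
      HasSum (fun k : ℕ => (-1) ^ k * q ^ ((k : ℤ) * (3 * (k : ℤ) - 2)) /
        (qPoch (q ^ 4) (q ^ 4) k * qPoch (-q) (q ^ 2) k)) S ∧
      rrH q = qPochInf (-q) q * S ∧
      S = 1 / (qPochInf (-q) q *
        (qPochInf (q ^ 2) (q ^ 5) * qPochInf (q ^ 3) (q ^ 5)))) := by
  have hr2 : (r ^ 2) ^ 2 = q := by rw [← hr]; ring
  have hp : ‖r ^ 2‖ < 1 := by
    rw [← hr2, norm_pow] at hq
    exact (pow_lt_one_iff_of_nonneg (norm_nonneg _) two_ne_zero).1 hq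
  have hneg : qPochInf (-q) q ≠ 0 := qPochInf_ne_zero (by rwa [norm_neg]) hq
  refine ⟨summable_rrR hq q, rrH_eq hq,
    exists_hasSum_of_hasSum_mul (qPochInf_ne_zero hp hq) ?_ (rrH_eq hq),
    exists_hasSum_of_hasSum_mul hneg (hasSum_rrH_neg_succ hq) (rrH_eq hq),
    exists_hasSum_of_hasSum_mul hneg ?_ (rrH_eq hq)⟩
  · have h := hasSum_rrH_sq hp
    rw [hr2] at h
    convert h using 4 with k
    rw [← pow_mul]
    congr 1
    have := sq_eq_choose_two k
    nlinarith
  · convert hasSum_rrH_neg hq using 5 with k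
    rw [← zpow_natCast]
    congr 1
    -- Truncated subtraction differs from the integer one only at `k = 0`, where the factor `k`
    -- makes both exponents `0`.
    rcases k with _ | k
    · simp
    · rw [show 3 * (k + 1) - 2 = 3 * k + 1 by omega]
      push_cast
      ring
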